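/- Let $\Gamma$ be a metrized graph, i.e. a finite connected graph (multiple edges and self-loops allowed) with finite non-empty vertex set $V$ and edges $e_i$ parametrized by intervals of length $L_i>0$. Let $\ell(\Gamma)=\sum_i L_i$, let $\upsilon(p)$ be the valence of a vertex $p$ (a self-loop counts twice), and let $r(x,y)$ be the effective resistance between $x,y\in\Gamma$ when each edge is viewed as a resistor whose resistance is its length. Let $R_i$ be the effective resistance between the end points of $e_i$ after the interior of $e_i$ is deleted ($R_i=\infty$, $\frac{1}{L_i+R_i}=0$ if $e_i$ is a bridge). For ${\bf q}:V\to\mathbb{N}=\{0,1,\dots\}$, the pair $(\Gamma,{\bf q})$ is a polarized metrized graph (pm-graph) if $\upsilon(p)-2+2{\bf q}(p)\ge 0$ for all $p\in V$. Its genus is $\bar g(\Gamma)=|E|-|V|+1+\sum_{p}{\bf q}(p)$, where $E$ is the set of edges. Put $$\delta_K=\sum_{p\in V}(\upsilon(p)-2+2{\bf q}(p))\,\delta_p,\qquad \mu_{ad}=\frac{1}{\bar g}\Big(\sum_{p\in V}{\bf q}(p)\,\delta_p+\sum_{i}\frac{dx}{L_i+R_i}\Big),$$ $$\epsilon(\Gamma)=\iint_{\Gamma\times\Gamma}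 r(x,y)\,\delta_K(x)\,\mu_{ad}(y),\qquad Z(\Gamma)=\frac12\iint_{\Gamma\times\Gamma} r(x,y)\,\mu_{ad}(x)\,\mu_{ad}(y),$$ $$\varphi(\Gamma)=3\bar g\, Z(\Gamma)-\tfrac14(\epsilon(\Gamma)+\ell(\Gamma)),\qquad \lambda(\Gamma)=\frac{\bar g-1}{6(2\bar g+1)}\varphi(\Gamma)+\tfrac1{12}(\epsilon(\Gamma)+\ell(\Gamma)).$$ Let $(\Gamma,{\bf q})$ be a pm-graph with a self-loop of length $L$ at a vertex $p$ with $\upsilon(p)\ge 3$. Let $\beta$ be the graph obtained from $\Gamma$ by deleting (the interior of) this self-loop, with $\bar{\bf q}(p)={\bf q}(p)+1$ and $\bar{\bf q}(x)={\bf q}(x)$ for the vertices $x\neq p$. Then $(\beta,\bar{\bf q})$ is a pm-graph with $\bar g(\beta)=\bar g(\Gamma)$, and with $\bar g=\bar g(\Gamma)$, $$\varphi(\Gamma)=\varphi(\beta)+\frac{\bar g-1}{6\bar g}L,\qquad Z(\Gamma)=Z(\beta)+\frac{2\bar g-1}{12\bar g^2}L,$$ $$\lambda(\Gamma)=\lambda(\beta)+\frac{\bar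 g}{8\bar g+4}L,\qquad \epsilon(\Gamma)=\epsilon(\beta)+\frac{\bar g-1}{3\bar g}L.$$ -/

import Mathlib

open MeasureTheory
open scoped ENNReal

noncomputable section

/-- A finite multigraph (multiple edges and self-loops allowed) with vertices `V`, edges `E` and
positive edge lengths.  The edge `e` is parametrized by `[0, len e]`, from `src e` to `tgt e`.
Connectedness is a separate predicate, because deleting an edge may destroy it. -/
structure MetricMultigraph (V E : Type*) where
  src : E → V
  tgt : E → V
  len : E → ℝ
  len_pos : ∀ e, 0 < len e

namespace MetricMultigraph

/-- Nonempty and any two vertices are joined by a path (edges may be traversed both ways). -/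
def Connected {V E : Type*} (G : MetricMultigraph V E) : Prop :=
  Nonempty V ∧ ∀ u v : V, Relation.EqvGen (fun a b => ∃ e, G.src e = a ∧ G.tgt e = b) u v

/-- The points of the metrized graph: the vertices and the interior points of the edges;
`Sum.inr ⟨e, t⟩` is the point of `e` at distance `t` from `src e` along `e`. -/
def Point {V E : Type*} (G : MetricMultigraph V E) : Type _ :=
  V ⊕ (Σ e : E, Set.Ioo (0 : ℝ) (G.len e))

/-- The Borel sigma-algebra of the metrized graph: a set is measurable iff its trace on each
open edge is Borel. -/
instance {V E : Type*} (G : MetricMultigraph V E) : MeasurableSpace G.Point :=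
  letI : MeasurableSpace V := ⊤
  inferInstanceAs (MeasurableSpace (V ⊕ (Σ e : E, Set.Ioo (0 : ℝ) (G.len e))))

/-- A vertex as a point of the metrized graph. -/
def vertex {V E : Type*} (G : MetricMultigraph V E) (v : V) : G.Point := Sum.inl v

/-- The point in the interior of the edge `e` with parameter `t`. -/
def onEdge {V E : Type*} (G : MetricMultigraph V E) (e : E) (t : Set.Ioo (0 : ℝ) (G.len e)) :
    G.Point := Sum.inr ⟨e, t⟩

/-- Deletion of the interior of an edge. -/
def deleteEdge {V E : Type*} (G : MetricMultigraph V E) (e : E) :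
    MetricMultigraph V {e' : E // e' ≠ e} where
  src e' := G.src e'
  tgt e' := G.tgt e'
  len e' := G.len e'
  len_pos e' := G.len_pos e'

/-- Enlarging the vertex set by the interior point of `e` with parameter `t`.  The new vertex is
`none`; the edge `some e` is the part of `e` before it and the edge `none` the part after it. -/
def subdivide {V E : Type*} [DecidableEq E] (G : MetricMultigraph V E) (e : E)
    (t : Set.Ioo (0 : ℝ) (G.len e)) : MetricMultigraph (Option V) (Option E) where
  src
    | none => none
    | some e' => some (G.src e')
  tgt
    | none => some (G.tgt e)
    | some e' => if e' = e then none else some (G.tgt e')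
  len
    | none => G.len e - t
    | some e' => if e' = e then t else G.len e'
  len_pos
    | none => sub_pos.2 t.2.2
    | some e' => by
        show 0 < if e' = e then (t : ℝ) else G.len e'
        split_ifs
        · exact t.2.1
        · exact G.len_pos e'

/-- The same point, seen in the graph with the enlarged vertex set. -/
def toSubdivide {V E : Type*} [DecidableEq E] (G : MetricMultigraph V E) (e : E)
    (t : Set.Ioo (0 : ℝ) (G.len e)) : G.Point → (G.subdivide e t).Point
  | Sum.inl v => vertex _ (some v)
  | Sum.inr ⟨e', s⟩ =>
      if h : e' = e then
        if hlt : (s : ℝ) < t then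
          onEdge _ (some e') ⟨s, s.2.1, by simpa [subdivide, h] using hlt⟩
        else if hgt : (t : ℝ) < s then
          onEdge _ none ⟨s - t, sub_pos.2 hgt, by
            subst h
            exact sub_lt_sub_right s.2.2 _⟩
        else vertex _ none
      else onEdge _ (some e') ⟨s, s.2.1, by simpa [subdivide, h] using s.2.2⟩

/-- `f` is the potential in the resistive circuit `G` (each edge being a resistor whose resistance
is its length) when a unit current enters at `y` and exits at `x`: by Ohm's law the current
along `e`, from `src e` to `tgt e`, is `(f (src e) - f (tgt e)) / len e`, and by Kirchhoff's law
the total current leaving a node along its edges is the current fed into the node. -/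
def IsPotential {V E : Type*} [DecidableEq V] [Fintype E] (G : MetricMultigraph V E)
    (x y : V) (f : V → ℝ) : Prop :=
  ∀ v : V,
    ∑ e : E, ((if G.src e = v then 1 else 0) - (if G.tgt e = v then 1 else 0)) *
        ((f (G.src e) - f (G.tgt e)) / G.len e) =
      (if v = y then 1 else 0) - (if v = x then 1 else 0)

/-- The potential drop does not depend on the choice of the potential. -/
theorem IsPotential.drop_eq {V E : Type*} [DecidableEq V] [Fintype V] [Fintype E]
    {G : MetricMultigraph V E} {x y : V} {f g : V → ℝ}
    (hf : G.IsPotential x y f) (hg : G.IsPotential x y g) : f y - f x = g y - g x := by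
  have key : ∀ a b : V → ℝ, G.IsPotential x y a →
      b y - b x = ∑ e : E, (b (G.src e) - b (G.tgt e)) *
        ((a (G.src e) - a (G.tgt e)) / G.len e) := by
    intro a b ha
    have h1 : b y - b x
        = ∑ v : V, b v * ((if v = y then 1 else 0) - (if v = x then 1 else 0)) := by
      simp [mul_sub, Finset.sum_sub_distrib]
    rw [h1, Finset.sum_congr rfl fun v _ => by rw [← ha v, Finset.mul_sum], Finset.sum_comm]
    refine Finset.sum_congr rfl fun e _ => ?_
    simp only [← mul_assoc, ← Finset.sum_mul]
    congr 1
    simp [mul_sub, Finset.sum_sub_distrib]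
  rw [key g f hg, key f g hf]
  refine Finset.sum_congr rfl fun e _ => ?_
  ring

/-- The effective resistance between two vertices: the potential difference needed for a unit
current, and `∞` if no current can flow (the vertices lie in different components). -/
def effRes {V E : Type*} [DecidableEq V] [Fintype E] (G : MetricMultigraph V E)
    (x y : V) : ℝ≥0∞ :=
  ⨅ (f : V → ℝ) (_ : G.IsPotential x y f), ENNReal.ofReal (f y - f x)

theorem effRes_eq {V E : Type*} [DecidableEq V] [Fintype V] [Fintype E]
    {G : MetricMultigraph V E} {x y : V} {f : V → ℝ} (hf : G.IsPotential x y f) :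
    G.effRes x y = ENNReal.ofReal (f y - f x) :=
  le_antisymm (iInf₂_le f hf)
    (le_iInf₂ fun _ hg => (congrArg ENNReal.ofReal (hf.drop_eq hg)).le)

/-- The resistance function `r(x, y)` on the points of a metrized graph: the terminals are first
made vertices by enlarging the vertex set. -/
def r {V E : Type*} [DecidableEq V] [DecidableEq E] [Fintype E]
    (G : MetricMultigraph V E) : G.Point → G.Point → ℝ
  | Sum.inl x, Sum.inl y => (G.effRes x y).toReal
  | Sum.inl x, Sum.inr ⟨e, t⟩ => ((G.subdivide e t).effRes (some x) none).toReal
  | Sum.inr ⟨e, t⟩, y =>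
      match G.toSubdivide e t y with
      | Sum.inl y' => ((G.subdivide e t).effRes none y').toReal
      | Sum.inr ⟨e', t'⟩ =>
          (((G.subdivide e t).subdivide e' t').effRes (some none) none).toReal

/-- `R_e`: the resistance between the end points of `e` after deleting the interior of `e`
(`∞` if `e` is a bridge). -/
def edgeRes {V E : Type*} [DecidableEq V] [DecidableEq E] [Fintype E]
    (G : MetricMultigraph V E) (e : E) : ℝ≥0∞ :=
  (G.deleteEdge e).effRes (G.src e) (G.tgt e)

/-- The number of directions emanating from a vertex; a self-loop counts twice. -/
def valence {V E : Type*} [DecidableEq V] [Fintype E] (G : MetricMultigraph V E) (p : V) : ℕ :=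
  (Finset.univ.filter fun e => G.src e = p).card + (Finset.univ.filter fun e => G.tgt e = p).card

/-- The total length `ℓ`. -/
def totalLength {V E : Type*} [Fintype E] (G : MetricMultigraph V E) : ℝ := ∑ e, G.len e

/-- The coefficient at `p` of the canonical divisor of `(G, q)`. -/
def K {V E : Type*} [DecidableEq V] [Fintype E] (G : MetricMultigraph V E) (q : V → ℕ) (p : V) :
    ℤ :=
  G.valence p - 2 + 2 * q p

/-- `(G, q)` is a polarized metrized graph: `G` is connected and the canonical divisor is
effective. -/
def IsPMGraph {V E : Type*} [DecidableEq V] [Fintype E] (G : MetricMultigraph V E)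
    (q : V → ℕ) : Prop :=
  G.Connected ∧ ∀ p, 0 ≤ G.K q p

/-- The genus of `(G, q)`: first Betti number plus the sum of the values of `q`. -/
def genus {V E : Type*} [Fintype V] [Fintype E] (_G : MetricMultigraph V E) (q : V → ℕ) : ℤ :=
  ((Fintype.card E : ℤ) - Fintype.card V + 1) + ∑ p, (q p : ℤ)

theorem measurable_onEdge {V E : Type*} (G : MetricMultigraph V E) (e : E) :
    Measurable (G.onEdge e) :=
  letI : MeasurableSpace V := ⊤
  measurable_inr.comp (measurable_iff_le_map.2 (iInf_le _ e))

/-- Lebesgue measure `dx` on the edge `e`. -/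
def edgeMeasure {V E : Type*} (G : MetricMultigraph V E) (e : E) : Measure G.Point :=
  ((volume : Measure ℝ).comap ((↑) : Set.Ioo (0 : ℝ) (G.len e) → ℝ)).map (G.onEdge e)

/-- The measure `δ_K` (used only when `K` is effective). -/
def deltaK {V E : Type*} [DecidableEq V] [Fintype V] [Fintype E] (G : MetricMultigraph V E)
    (q : V → ℕ) : Measure G.Point :=
  ∑ p, ENNReal.ofReal (G.K q p : ℝ) • Measure.dirac (G.vertex p)

/-- The admissible measure `μ_ad` of `(G, q)`; a bridge has density `1 / (L + ∞) = 0`. -/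
def muAd {V E : Type*} [DecidableEq V] [DecidableEq E] [Fintype V] [Fintype E]
    (G : MetricMultigraph V E) (q : V → ℕ) : Measure G.Point :=
  (ENNReal.ofReal (G.genus q : ℝ))⁻¹ •
    (∑ p, (q p : ℝ≥0∞) • Measure.dirac (G.vertex p) +
      ∑ e, (ENNReal.ofReal (G.len e) + G.edgeRes e)⁻¹ • G.edgeMeasure e)

/-- The invariant `ε`. -/
def epsilonInv {V E : Type*} [DecidableEq V] [DecidableEq E] [Fintype V] [Fintype E]
    (G : MetricMultigraph V E) (q : V → ℕ) : ℝ :=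
  ∫ x, ∫ y, G.r x y ∂(G.muAd q) ∂(G.deltaK q)

/-- The invariant `Z`. -/
def zInv {V E : Type*} [DecidableEq V] [DecidableEq E] [Fintype V] [Fintype E]
    (G : MetricMultigraph V E) (q : V → ℕ) : ℝ :=
  (1 / 2) * ∫ x, ∫ y, G.r x y ∂(G.muAd q) ∂(G.muAd q)

/-- The invariant `φ`. -/
def phiInv {V E : Type*} [DecidableEq V] [DecidableEq E] [Fintype V] [Fintype E]
    (G : MetricMultigraph V E) (q : V → ℕ) : ℝ :=
  3 * (G.genus q : ℝ) * G.zInv q - (1 / 4) * (G.epsilonInv q + G.totalLength)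

/-- The invariant `λ`. -/
def lambdaInv {V E : Type*} [DecidableEq V] [DecidableEq E] [Fintype V] [Fintype E]
    (G : MetricMultigraph V E) (q : V → ℕ) : ℝ :=
  ((G.genus q : ℝ) - 1) / (6 * (2 * (G.genus q : ℝ) + 1)) * G.phiInv q +
    (1 / 12) * (G.epsilonInv q + G.totalLength)

end MetricMultigraph

end

/-!
If `f` is a vertex potential whose Laplacian is the difference of the barycentric coordinates of `y`
and `x`, then `r x y` is the energy of `f` plus the sum over all edges of `u * (l - u) / l`, the
resistance between two points at distance `u` on a circle of the length `l` of the edge, where `u`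
is the difference of the coordinates of `x` and `y` along the edge. A self-loop at `p` contributes
nothing to the Laplacian, and all its points have the barycentric coordinates of `p`. So deleting it
does not change `r` on the rest of the graph, and a point of the loop at distance `u` from `p` is
farther by `u * (L - u) / L` than `p` from every point outside the loop.

The canonical divisor is unchanged, and the admissible measure `μ` (a probability measure by
Foster's theorem) changes only by moving mass `1 / g` from `p` to the uniform distribution on the
loop. As the mean of `u * (L - u) / L` over the loop is `L / 6`, the potential of `μ` increases by
`L / (6 * g)` outside the loop, and at a point of the loop it exceeds its value at `p` by
`(1 - 1 / g) * u * (L - u) / L`. Integrating it against the canonical divisor and against `μ` gives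
`ε` and `Z`; the formulas for `φ` and `λ` are then algebra.
-/

noncomputable section

namespace MetricMultigraph

section LoopResistance

/-- The resistance between two points at distance `u` along a circle of length `l`, i.e. of the
arcs `u` and `l - u` in parallel. -/
def loopRes (l u : ℝ) : ℝ := u * (l - u) / l

@[simp]
theorem loopRes_zero_right (l : ℝ) : loopRes l 0 = 0 := by simp [loopRes]

theorem loopRes_sub (l u : ℝ) : loopRes l (l - u) = loopRes l u := by
  simp only [loopRes]; ring

@[fun_prop]
theorem continuous_loopRes (l : ℝ) : Continuous (loopRes l) := by
  unfold loopRes; fun_prop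

theorem integral_loopRes {l : ℝ} (hl : l ≠ 0) : ∫ u in 0..l, loopRes l u = l ^ 2 / 6 := by
  have hInt (n : ℕ) : IntervalIntegrable (fun u : ℝ => u ^ n) volume 0 l :=
    (continuous_pow n).intervalIntegrable 0 l
  calc ∫ u in 0..l, loopRes l u = ∫ u in 0..l, (u ^ 1 - l⁻¹ * u ^ 2) := by
        congr with u; simp only [loopRes]; field_simp
    _ = l ^ 2 / 6 := by
        rw [intervalIntegral.integral_sub (hInt 1) ((hInt 2).const_mul _),
          intervalIntegral.integral_const_mul, integral_pow, integral_pow]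
        norm_num
        field_simp
        norm_num

theorem integral_loopRes_abs_sub {l s : ℝ} (hl : l ≠ 0) (hs : s ∈ Set.Icc 0 l) :
    ∫ u in 0..l, loopRes l |u - s| = l ^ 2 / 6 := by
  have hInt {f : ℝ → ℝ} (hf : Continuous f) (a b : ℝ) : IntervalIntegrable f volume a b :=
    hf.intervalIntegrable a b
  have left : ∫ u in 0..s, loopRes l |u - s| = ∫ u in 0..s, loopRes l u := calc
    _ = ∫ u in 0..s, loopRes l (s - u) := intervalIntegral.integral_congr fun u hu => by
      rw [Set.uIcc_of_le hs.1] at hu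
      simp only [abs_sub_comm u s, abs_of_nonneg (sub_nonneg.2 hu.2)]
    _ = _ := by rw [intervalIntegral.integral_comp_sub_left, sub_self, sub_zero]
  have right : ∫ u in s..l, loopRes l |u - s| = ∫ u in s..l, loopRes l u := calc
    _ = ∫ u in s..l, loopRes l (l + s - u) := intervalIntegral.integral_congr fun u hu => by
      rw [Set.uIcc_of_le hs.2] at hu
      simp only [abs_of_nonneg (sub_nonneg.2 hu.1), ← loopRes_sub l (u - s), sub_sub_eq_add_sub]
    _ = _ := by
      rw [intervalIntegral.integral_comp_sub_left, add_sub_cancel_left, add_sub_cancel_right]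
  rw [← intervalIntegral.integral_add_adjacent_intervals (b := s) (hInt (by fun_prop) _ _)
    (hInt (by fun_prop) _ _), left, right, intervalIntegral.integral_add_adjacent_intervals
    (hInt (by fun_prop) _ _) (hInt (by fun_prop) _ _), integral_loopRes hl]

end LoopResistance

section Laplacian

variable {V E : Type*} [DecidableEq V] [Fintype E]

/-- The discrete Laplacian: `lap f v` is the current fed into the circuit at `v` when the potential
at the vertices is `f`. -/
def lap (G : MetricMultigraph V E) : (V → ℝ) →ₗ[ℝ] V → ℝ where
  toFun f := ∑ e, ((f (G.src e) - f (G.tgt e)) / G.len e) •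
    (Pi.single (G.src e) (1 : ℝ) - Pi.single (G.tgt e) 1)
  map_add' f g := by
    rw [← Finset.sum_add_distrib]
    refine Finset.sum_congr rfl fun e _ => ?_
    rw [← add_smul, ← add_div, Pi.add_apply, Pi.add_apply, add_sub_add_comm]
  map_smul' c f := by
    rw [RingHom.id_apply, Finset.smul_sum]
    refine Finset.sum_congr rfl fun e _ => ?_
    rw [← mul_smul, ← mul_div_assoc, mul_sub]
    rfl

theorem lap_apply (G : MetricMultigraph V E) (f : V → ℝ) :
    G.lap f = ∑ e, ((f (G.src e) - f (G.tgt e)) / G.len e) •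
      (Pi.single (G.src e) (1 : ℝ) - Pi.single (G.tgt e) 1) := rfl

theorem isPotential_iff {G : MetricMultigraph V E} {x y : V} {f : V → ℝ} :
    G.IsPotential x y f ↔ G.lap f = Pi.single y 1 - Pi.single x 1 := by
  simp only [IsPotential, funext_iff, lap_apply, Finset.sum_apply, Pi.smul_apply, Pi.sub_apply,
    Pi.single_apply, smul_eq_mul, mul_comm (_ - _ : ℝ) (_ / _), eq_comm (a := G.src _),
    eq_comm (a := G.tgt _)]

variable [Fintype V]

theorem dotProduct_lap (G : MetricMultigraph V E) (f g : V → ℝ) :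
    g ⬝ᵥ G.lap f =
      ∑ e, (f (G.src e) - f (G.tgt e)) * (g (G.src e) - g (G.tgt e)) / G.len e := by
  rw [lap_apply, dotProduct_sum]
  refine Finset.sum_congr rfl fun e _ => ?_
  rw [dotProduct_smul, dotProduct_sub, dotProduct_single_one, dotProduct_single_one, smul_eq_mul,
    div_mul_eq_mul_div]

theorem lap_dotProduct_comm (G : MetricMultigraph V E) (f g : V → ℝ) :
    G.lap f ⬝ᵥ g = f ⬝ᵥ G.lap g := by
  rw [dotProduct_comm, dotProduct_lap, dotProduct_lap]
  simp only [mul_comm]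

theorem dotProduct_lap_self_nonneg (G : MetricMultigraph V E) (f : V → ℝ) :
    0 ≤ f ⬝ᵥ G.lap f := by
  rw [dotProduct_lap]
  exact Finset.sum_nonneg fun e _ => div_nonneg (mul_self_nonneg _) (G.len_pos e).le

theorem sum_lap (G : MetricMultigraph V E) (f : V → ℝ) : ∑ v, G.lap f v = 0 := by
  simpa [one_dotProduct] using dotProduct_lap G f 1

theorem IsPotential.drop_nonneg {G : MetricMultigraph V E} {x y : V} {f : V → ℝ}
    (hf : G.IsPotential x y f) : 0 ≤ f y - f x := by
  simpa [isPotential_iff.1 hf, dotProduct_sub] using G.dotProduct_lap_self_nonneg f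

theorem IsPotential.effRes_toReal {G : MetricMultigraph V E} {x y : V} {f : V → ℝ}
    (hf : G.IsPotential x y f) : (G.effRes x y).toReal = f y - f x := by
  rw [effRes_eq hf, ENNReal.toReal_ofReal hf.drop_nonneg]

theorem Connected.eq_of_dotProduct_lap_eq_zero {G : MetricMultigraph V E} (hG : G.Connected)
    {f : V → ℝ} (hf : f ⬝ᵥ G.lap f = 0) (u v : V) : f u = f v := by
  have nonneg (e : E) : 0 ≤ (f (G.src e) - f (G.tgt e)) * (f (G.src e) - f (G.tgt e)) / G.len e :=
    div_nonneg (mul_self_nonneg _) (G.len_pos e).le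
  have edge (e : E) : f (G.src e) = f (G.tgt e) := by
    have h := (Finset.sum_eq_zero_iff_of_nonneg fun e _ => nonneg e).1
      ((G.dotProduct_lap f f).symm.trans hf) e (Finset.mem_univ e)
    rwa [div_eq_zero_iff, or_iff_left (G.len_pos e).ne', mul_self_eq_zero, sub_eq_zero] at h
  induction hG.2 u v with
  | rel a b h =>
    obtain ⟨e, rfl, rfl⟩ := h
    exact edge e
  | refl a => rfl
  | symm a b _ ih => exact ih.symm
  | trans a b c _ _ ih₁ ih₂ => exact ih₁.trans ih₂

/-- Grounding the vertex `z` through a unit resistor makes the Laplacian invertible. -/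
theorem Connected.exists_green {G : MetricMultigraph V E} (hG : G.Connected) (z : V) :
    ∃ γ : (V → ℝ) →ₗ[ℝ] V → ℝ, ∀ b, G.lap (γ b) = b - (∑ v, b v) • Pi.single z 1 := by
  let T : (V → ℝ) →ₗ[ℝ] V → ℝ := G.lap + (LinearMap.proj z).smulRight (Pi.single z 1)
  have hT (f : V → ℝ) : T f = G.lap f + f z • Pi.single z 1 := rfl
  have injective : Function.Injective T := by
    refine (injective_iff_map_eq_zero T).2 fun f hf => ?_
    have energy : f ⬝ᵥ G.lap f + f z * f z = 0 := by
      simpa [hT, dotProduct_add, dotProduct_smul] using congrArg (f ⬝ᵥ ·) hf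
    have hz : f z = 0 := mul_self_eq_zero.1 <| le_antisymm
      (by linarith [G.dotProduct_lap_self_nonneg f]) (mul_self_nonneg _)
    have hconst := hG.eq_of_dotProduct_lap_eq_zero (f := f) (by simpa [hz] using energy)
    exact funext fun v => (hconst v z).trans hz
  let Tinv := LinearEquiv.ofInjectiveEndo T injective
  refine ⟨Tinv.symm, fun b => ?_⟩
  have hb : G.lap (Tinv.symm b) + Tinv.symm b z • Pi.single z 1 = b := Tinv.apply_symm_apply b
  have mass : Tinv.symm b z = ∑ v, b v := by
    simpa [Finset.sum_add_distrib, sum_lap, ← Finset.mul_sum] using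
      congrArg (fun f => ∑ v, f v) hb
  rw [← mass]
  exact eq_sub_of_add_eq hb

theorem Connected.exists_lap_eq {G : MetricMultigraph V E} (hG : G.Connected) {b : V → ℝ}
    (hb : ∑ v, b v = 0) : ∃ f, G.lap f = b := by
  obtain ⟨z⟩ := hG.1
  obtain ⟨γ, hγ⟩ := hG.exists_green z
  exact ⟨γ b, by rw [hγ, hb, zero_smul, sub_zero]⟩

end Laplacian

section Coordinates

variable {V E : Type*}

@[elab_as_elim]
theorem Point.cases {G : MetricMultigraph V E} {motive : G.Point → Prop}
    (vertex : ∀ v, motive (G.vertex v)) (onEdge : ∀ e t, motive (G.onEdge e t)) (x : G.Point) :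
    motive x :=
  match x with
  | Sum.inl v => vertex v
  | Sum.inr ⟨e, t⟩ => onEdge e t

/-- Barycentric coordinates: the point of `e` at distance `t` from `src e` is
`(1 - t / len e) * src e + (t / len e) * tgt e`. -/
def bary [DecidableEq V] (G : MetricMultigraph V E) : G.Point → V → ℝ
  | Sum.inl v => Pi.single v 1
  | Sum.inr ⟨e, t⟩ =>
      (1 - t / G.len e) • Pi.single (G.src e) 1 + (t / G.len e : ℝ) • Pi.single (G.tgt e) 1

/-- Edge coordinates: the distance from `src e` along `e`, and `0` for the points which are not in
the interior of `e`. -/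
def pos [DecidableEq E] (G : MetricMultigraph V E) : G.Point → E → ℝ
  | Sum.inl _ => 0
  | Sum.inr ⟨e, t⟩ => Pi.single e (t : ℝ)

section bary

variable [DecidableEq V] (G : MetricMultigraph V E)

@[simp]
theorem bary_vertex (v : V) : G.bary (G.vertex v) = Pi.single v 1 := rfl

theorem bary_onEdge (e : E) (t : Set.Ioo (0 : ℝ) (G.len e)) :
    G.bary (G.onEdge e t) =
      (1 - t / G.len e) • Pi.single (G.src e) 1 + (t / G.len e : ℝ) • Pi.single (G.tgt e) 1 := rfl

theorem bary_onEdge_of_loop {G : MetricMultigraph V E} {e : E} (he : G.src e = G.tgt e)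
    (t : Set.Ioo (0 : ℝ) (G.len e)) :
    G.bary (G.onEdge e t) = G.bary (G.vertex (G.src e)) := by
  rw [bary_onEdge, ← he, ← add_smul, sub_add_cancel, one_smul, bary_vertex]

theorem bary_mem_stdSimplex [Fintype V] (x : G.Point) : G.bary x ∈ stdSimplex ℝ V := by
  induction x using Point.cases with
  | vertex v => exact single_mem_stdSimplex ℝ v
  | onEdge e t =>
    have hl := G.len_pos e
    exact convex_stdSimplex ℝ V (single_mem_stdSimplex ℝ _) (single_mem_stdSimplex ℝ _)
      (sub_nonneg.2 ((div_le_one hl).2 t.2.2.le)) (div_nonneg t.2.1.le hl.le)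
      (sub_add_cancel _ _)

theorem sum_bary [Fintype V] (x : G.Point) : ∑ v, G.bary x v = 1 :=
  (G.bary_mem_stdSimplex x).2

theorem Connected.exists_lap_eq_bary_sub [Fintype V] [Fintype E] {G : MetricMultigraph V E}
    (hG : G.Connected) (x y : G.Point) : ∃ f, G.lap f = G.bary y - G.bary x :=
  hG.exists_lap_eq (by simp [sum_bary])

end bary

section pos

variable [DecidableEq E] (G : MetricMultigraph V E)

@[simp]
theorem pos_vertex (v : V) : G.pos (G.vertex v) = 0 := rfl

@[simp]
theorem pos_onEdge (e : E) (t : Set.Ioo (0 : ℝ) (G.len e)) :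
    G.pos (G.onEdge e t) = Pi.single e (t : ℝ) := rfl

theorem pos_mem_Icc (x : G.Point) (e : E) : G.pos x e ∈ Set.Icc 0 (G.len e) := by
  induction x using Point.cases with
  | vertex v => exact ⟨le_rfl, (G.len_pos e).le⟩
  | onEdge e' t =>
    rw [pos_onEdge]
    obtain rfl | h := eq_or_ne e e'
    · rw [Pi.single_eq_same]
      exact ⟨t.2.1.le, t.2.2.le⟩
    · rw [Pi.single_eq_of_ne h]
      exact ⟨le_rfl, (G.len_pos e).le⟩

variable [Fintype E]

/-- The part of `r x y` that depends only on the edge coordinates of `x` and `y`; the rest is the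
energy of the potential of `bary y - bary x`, see `r_eq`. -/
def edgeTerm (x y : G.Point) : ℝ := ∑ e, loopRes (G.len e) |G.pos y e - G.pos x e|

theorem edgeTerm_vertex_left (v : V) (y : G.Point) :
    G.edgeTerm (G.vertex v) y = ∑ e, loopRes (G.len e) (G.pos y e) := by
  simp [edgeTerm, abs_of_nonneg (G.pos_mem_Icc y _).1]

end pos

end Coordinates

section Subdivision

variable {V E : Type*} [DecidableEq E] (G : MetricMultigraph V E) (e : E)
  (t : Set.Ioo (0 : ℝ) (G.len e))

@[simp]
theorem subdivide_src_none : (G.subdivide e t).src none = none := rfl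

@[simp]
theorem subdivide_src_some (e' : E) : (G.subdivide e t).src (some e') = some (G.src e') := rfl

@[simp]
theorem subdivide_tgt_none : (G.subdivide e t).tgt none = some (G.tgt e) := rfl

@[simp]
theorem subdivide_tgt_some_self : (G.subdivide e t).tgt (some e) = none := if_pos rfl

@[simp]
theorem subdivide_tgt_some_of_ne {e' : E} (h : e' ≠ e) :
    (G.subdivide e t).tgt (some e') = some (G.tgt e') := if_neg h

@[simp]
theorem subdivide_len_none : (G.subdivide e t).len none = G.len e - t := rfl

@[simp]
theorem subdivide_len_some_self : (G.subdivide e t).len (some e) = t := if_pos rfl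

@[simp]
theorem subdivide_len_some_of_ne {e' : E} (h : e' ≠ e) :
    (G.subdivide e t).len (some e') = G.len e' := if_neg h

@[elab_as_elim]
theorem toSubdivide_cases {motive : G.Point → (G.subdivide e t).Point → Prop}
    (vertex : ∀ v, motive (G.vertex v) (vertex _ (some v)))
    (other : ∀ e' (_ : e' ≠ e) (s : Set.Ioo (0 : ℝ) (G.len e'))
      (s' : Set.Ioo (0 : ℝ) ((G.subdivide e t).len (some e'))), (s' : ℝ) = s →
      motive (G.onEdge e' s) (onEdge _ (some e') s'))
    (before : ∀ (s : Set.Ioo (0 : ℝ) (G.len e))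
      (s' : Set.Ioo (0 : ℝ) ((G.subdivide e t).len (some e))), s < t → (s' : ℝ) = s →
      motive (G.onEdge e s) (onEdge _ (some e) s'))
    (same : motive (G.onEdge e t) (MetricMultigraph.vertex _ none))
    (after : ∀ (s : Set.Ioo (0 : ℝ) (G.len e))
      (s' : Set.Ioo (0 : ℝ) ((G.subdivide e t).len none)), t < s → (s' : ℝ) = s - t →
      motive (G.onEdge e s) (onEdge _ none s'))
    (y : G.Point) : motive y (G.toSubdivide e t y) := by
  induction y using Point.cases with
  | vertex v => exact vertex v
  | onEdge e' s =>
    change motive _ (dite _ _ _)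
    by_cases he : e' = e
    · subst he
      rw [dif_pos rfl]
      obtain hlt | rfl | hgt := lt_trichotomy s t
      · rw [dif_pos (show (s : ℝ) < t from hlt)]
        exact before s _ hlt rfl
      · rw [dif_neg (lt_irrefl _), dif_neg (lt_irrefl _)]
        exact same
      · rw [dif_neg (show ¬(s : ℝ) < t from hgt.not_gt), dif_pos (show (t : ℝ) < s from hgt)]
        exact after s _ hgt rfl
    · rw [dif_neg he]
      exact other e' he s ⟨s, _⟩ rfl

theorem pos_toSubdivide_some_of_ne (y : G.Point) {e' : E}
    (h : e' ≠ e) : (G.subdivide e t).pos (G.toSubdivide e t y) (some e') = G.pos y e' := by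
  induction y using G.toSubdivide_cases e t with
  | vertex u => rfl
  | other e'' _ s s' hs => simp [Pi.single_apply, hs]
  | before s s' _ _ => simp [h]
  | same => simp [h]
  | after s s' _ _ => simp [h]

end Subdivision

section Subdivision

variable {V E : Type*} [DecidableEq V] (G : MetricMultigraph V E) (e : E)
  (t : Set.Ioo (0 : ℝ) (G.len e))

/-- The divisor on `V` with the same total mass and barycentre as the divisor `b` on the vertices
of the subdivided graph. -/
def restrictCharge (b : Option V → ℝ) : V → ℝ :=
  (fun v => b (some v)) + b none • G.bary (G.onEdge e t)

variable [Fintype V]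

/-- The function on the vertices of the subdivided graph which extends `f` and whose
Laplacian at the new vertex is `c`. -/
def extendPotential (f : V → ℝ) (c : ℝ) : Option V → ℝ
  | none => G.bary (G.onEdge e t) ⬝ᵥ f + c * loopRes (G.len e) t
  | some v => f v

theorem dotProduct_extendPotential (d : Option V → ℝ) (f : V → ℝ) :
    d ⬝ᵥ G.extendPotential e t f (d none) =
      G.restrictCharge e t d ⬝ᵥ f + d none ^ 2 * loopRes (G.len e) t := by
  rw [restrictCharge, add_dotProduct, smul_dotProduct, dotProduct, Fintype.sum_option]
  simp only [extendPotential, dotProduct, smul_eq_mul]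
  ring

theorem current_before (f : V → ℝ) (c : ℝ) :
    (f (G.src e) - G.extendPotential e t f c none) / t =
      (f (G.src e) - f (G.tgt e)) / G.len e - c * (1 - t / G.len e) := by
  have ht := t.2.1.ne'
  have hl := (G.len_pos e).ne'
  simp only [extendPotential, bary_onEdge, add_dotProduct, smul_dotProduct, single_one_dotProduct,
    smul_eq_mul, loopRes]
  field_simp
  ring

theorem current_after (f : V → ℝ) (c : ℝ) :
    (G.extendPotential e t f c none - f (G.tgt e)) / (G.len e - t) =
      (f (G.src e) - f (G.tgt e)) / G.len e + c * (t / G.len e) := by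
  have htl := (sub_pos.2 t.2.2).ne'
  have hl := (G.len_pos e).ne'
  simp only [extendPotential, bary_onEdge, add_dotProduct, smul_dotProduct, single_one_dotProduct,
    smul_eq_mul, loopRes]
  field_simp
  ring

variable [Fintype E] [DecidableEq E]

theorem lap_subdivide_extendPotential (f : V → ℝ) (c : ℝ) :
    (G.subdivide e t).lap (G.extendPotential e t f c) =
      ((f (G.src e) - f (G.tgt e)) / G.len e + c * (t / G.len e)) •
        (Pi.single none 1 - Pi.single (some (G.tgt e)) 1) +
      (((f (G.src e) - f (G.tgt e)) / G.len e - c * (1 - t / G.len e)) •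
        (Pi.single (some (G.src e)) 1 - Pi.single none 1) +
      ∑ e' : {e' // e' ≠ e}, ((f (G.src e') - f (G.tgt e')) / G.len e') •
        (Pi.single (some (G.src e')) (1 : ℝ) - Pi.single (some (G.tgt e')) 1)) := by
  rw [lap_apply, Fintype.sum_option, Fintype.sum_eq_add_sum_subtype_ne _ e, ← current_after,
    ← current_before]
  simp only [subdivide_src_none, subdivide_tgt_none, subdivide_len_none, subdivide_src_some,
    subdivide_tgt_some_self, subdivide_len_some_self]
  congr! 3 with e'
  rw [subdivide_tgt_some_of_ne _ _ _ e'.2, subdivide_len_some_of_ne _ _ _ e'.2]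
  rfl

theorem lap_extendPotential {f : V → ℝ} {d : Option V → ℝ}
    (h : G.lap f = G.restrictCharge e t d) :
    (G.subdivide e t).lap (G.extendPotential e t f (d none)) = d := by
  rw [lap_apply, Fintype.sum_eq_add_sum_subtype_ne _ e] at h
  rw [lap_subdivide_extendPotential]
  ext (_ | v)
  · simp only [Pi.add_apply, Pi.smul_apply, Pi.sub_apply, Finset.sum_apply, smul_eq_mul,
      Pi.single_apply, reduceCtorEq, if_true, if_false, sub_zero, mul_zero, Finset.sum_const_zero]
    ring
  · have hv := congrFun h v
    simp only [restrictCharge, bary_onEdge, Pi.add_apply, Pi.smul_apply, Pi.sub_apply,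
      Finset.sum_apply, smul_eq_mul, Pi.single_apply] at hv
    simp only [Pi.add_apply, Pi.smul_apply, Pi.sub_apply, Finset.sum_apply, smul_eq_mul,
      Pi.single_apply, Option.some.injEq, reduceCtorEq, if_false]
    linear_combination hv

end Subdivision

section Resistance

variable {V E : Type*} [DecidableEq V] [DecidableEq E] (G : MetricMultigraph V E)

theorem restrictCharge_bary_toSubdivide (e : E) (t : Set.Ioo (0 : ℝ) (G.len e)) (y : G.Point) :
    G.restrictCharge e t ((G.subdivide e t).bary (G.toSubdivide e t y)) = G.bary y := by
  have ht := t.2.1.ne'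
  have hl := (G.len_pos e).ne'
  have htl := (sub_pos.2 t.2.2).ne'
  ext v
  induction y using G.toSubdivide_cases e t with
  | vertex u => simp [restrictCharge, Pi.single_apply]
  | other e' he s s' hs =>
    simp [restrictCharge, bary_onEdge, he, hs, Pi.single_apply]
  | before s s' _ hs =>
    simp only [restrictCharge, bary_onEdge, hs, subdivide_src_some, subdivide_tgt_some_self,
      subdivide_len_some_self, Pi.add_apply, Pi.smul_apply, Pi.single_apply, Option.some.injEq,
      reduceCtorEq, if_true, if_false, smul_eq_mul]
    split_ifs <;> field_simp <;> ring
  | same => simp [restrictCharge]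
  | after s s' _ hs =>
    simp only [restrictCharge, bary_onEdge, hs, subdivide_src_none, subdivide_tgt_none,
      subdivide_len_none, Pi.add_apply, Pi.smul_apply, Pi.single_apply, Option.some.injEq,
      reduceCtorEq, if_true, if_false, smul_eq_mul]
    split_ifs <;> field_simp <;> ring

/-- The quadratic term is the one that `dotProduct_extendPotential` attributes to the new vertex. -/
theorem loopRes_pos_toSubdivide (e : E) (t : Set.Ioo (0 : ℝ) (G.len e)) (y : G.Point) :
    loopRes (G.len e - t) ((G.subdivide e t).pos (G.toSubdivide e t y) none) +
      loopRes t ((G.subdivide e t).pos (G.toSubdivide e t y) (some e)) +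
      ((G.subdivide e t).bary (G.toSubdivide e t y) none - 1) ^ 2 * loopRes (G.len e) t =
    loopRes (G.len e) |G.pos y e - t| := by
  have ht := t.2.1.ne'
  have hl := (G.len_pos e).ne'
  have htl := (sub_pos.2 t.2.2).ne'
  induction y using G.toSubdivide_cases e t with
  | vertex u => simp [abs_of_pos t.2.1]
  | other e' he s s' _ => simp [bary_onEdge, he, he.symm, abs_of_pos t.2.1]
  | before s s' hst hs =>
    simp only [loopRes, pos_onEdge, bary_onEdge, hs, subdivide_src_some, subdivide_tgt_some_self,
      subdivide_len_some_self, Pi.add_apply, Pi.smul_apply, Pi.single_apply, reduceCtorEq, if_true,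
      if_false, smul_eq_mul, abs_of_neg (sub_neg.2 (show (s : ℝ) < t from hst))]
    field_simp
    ring
  | same => simp
  | after s s' hst hs =>
    simp only [loopRes, pos_onEdge, bary_onEdge, hs, subdivide_src_none, subdivide_tgt_none,
      subdivide_len_none, Pi.add_apply, Pi.smul_apply, Pi.single_apply, reduceCtorEq, if_true,
      if_false, smul_eq_mul, abs_of_pos (sub_pos.2 (show (t : ℝ) < s from hst))]
    field_simp
    ring

variable [Fintype E]

theorem edgeTerm_onEdge_left (e : E) (t : Set.Ioo (0 : ℝ) (G.len e)) (y : G.Point) :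
    G.edgeTerm (G.onEdge e t) y =
      (G.subdivide e t).edgeTerm (vertex _ none) (G.toSubdivide e t y) +
        ((G.subdivide e t).bary (G.toSubdivide e t y) none - 1) ^ 2 * loopRes (G.len e) t := by
  have other : ∑ e' : {e' // e' ≠ e},
        loopRes (G.len e') |G.pos y e' - (Pi.single e (t : ℝ) : E → ℝ) e'| =
      ∑ e' : {e' // e' ≠ e}, loopRes ((G.subdivide e t).len (some e'))
        ((G.subdivide e t).pos (G.toSubdivide e t y) (some e')) := by
    refine Finset.sum_congr rfl fun e' _ => ?_
    rw [subdivide_len_some_of_ne _ _ _ e'.2, pos_toSubdivide_some_of_ne _ _ _ _ e'.2,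
      Pi.single_eq_of_ne e'.2, sub_zero, abs_of_nonneg (G.pos_mem_Icc y e').1]
  rw [edgeTerm_vertex_left, edgeTerm, Fintype.sum_option, Fintype.sum_eq_add_sum_subtype_ne _ e,
    Fintype.sum_eq_add_sum_subtype_ne _ e, pos_onEdge, other, Pi.single_eq_same,
    ← loopRes_pos_toSubdivide, subdivide_len_none, subdivide_len_some_self]
  ring

theorem r_vertex_vertex (x y : V) : G.r (G.vertex x) (G.vertex y) = (G.effRes x y).toReal := rfl

theorem r_vertex_onEdge (x : V) (e : E) (t : Set.Ioo (0 : ℝ) (G.len e)) :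
    G.r (G.vertex x) (G.onEdge e t) = (G.subdivide e t).r (vertex _ (some x)) (vertex _ none) := rfl

theorem r_onEdge_left (e : E) (t : Set.Ioo (0 : ℝ) (G.len e)) (y : G.Point) :
    G.r (G.onEdge e t) y = (G.subdivide e t).r (vertex _ none) (G.toSubdivide e t y) := by
  change (match G.toSubdivide e t y with
    | Sum.inl y' => ((G.subdivide e t).effRes none y').toReal
    | Sum.inr ⟨e', t'⟩ =>
      (((G.subdivide e t).subdivide e' t').effRes (some none) none).toReal) = _
  cases G.toSubdivide e t y <;> rfl

variable [Fintype V]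

theorem r_vertex_vertex_eq {x y : V} {f : V → ℝ}
    (h : G.lap f = G.bary (G.vertex y) - G.bary (G.vertex x)) :
    G.r (G.vertex x) (G.vertex y) =
      (G.bary (G.vertex y) - G.bary (G.vertex x)) ⬝ᵥ f + G.edgeTerm (G.vertex x) (G.vertex y) := by
  rw [r_vertex_vertex, (isPotential_iff.2 h).effRes_toReal, edgeTerm_vertex_left]
  simp [sub_dotProduct]

theorem r_vertex_left_eq {x : V} {y : G.Point} {f : V → ℝ}
    (h : G.lap f = G.bary y - G.bary (G.vertex x)) :
    G.r (G.vertex x) y =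
      (G.bary y - G.bary (G.vertex x)) ⬝ᵥ f + G.edgeTerm (G.vertex x) y := by
  induction y using Point.cases with
  | vertex y => exact G.r_vertex_vertex_eq h
  | onEdge e t =>
    let d : Option V → ℝ := Pi.single none 1 - Pi.single (some x) 1
    have hd : G.restrictCharge e t d = G.bary (G.onEdge e t) - G.bary (G.vertex x) := by
      ext v
      simp only [d, restrictCharge, bary_vertex, Pi.add_apply, Pi.sub_apply, Pi.smul_apply,
        Pi.single_apply, Option.some.injEq, reduceCtorEq, if_true, if_false, smul_eq_mul]
      ring
    rw [← hd] at h ⊢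
    have hlap : (G.subdivide e t).lap (G.extendPotential e t f (d none)) =
        (G.subdivide e t).bary (vertex _ none) - (G.subdivide e t).bary (vertex _ (some x)) :=
      G.lap_extendPotential e t h
    rw [r_vertex_onEdge, r_vertex_vertex_eq _ hlap, ← hlap, G.lap_extendPotential e t h,
      dotProduct_extendPotential, edgeTerm_vertex_left, edgeTerm_vertex_left]
    simp [d, Pi.single_apply, apply_ite]

theorem r_eq {x y : G.Point} {f : V → ℝ} (h : G.lap f = G.bary y - G.bary x) :
    G.r x y = (G.bary y - G.bary x) ⬝ᵥ f + G.edgeTerm x y := by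
  induction x using Point.cases with
  | vertex x => exact G.r_vertex_left_eq h
  | onEdge e t =>
    set y' := G.toSubdivide e t y
    let d : Option V → ℝ := (G.subdivide e t).bary y' - Pi.single none 1
    have hd : G.restrictCharge e t d = G.bary y - G.bary (G.onEdge e t) := by
      rw [← G.restrictCharge_bary_toSubdivide e t y]
      ext v
      simp only [d, restrictCharge, Pi.add_apply, Pi.sub_apply, Pi.smul_apply, Pi.single_apply,
        reduceCtorEq, if_true, if_false, smul_eq_mul]
      ring
    rw [← hd] at h ⊢
    have hlap : (G.subdivide e t).lap (G.extendPotential e t f (d none)) =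
        (G.subdivide e t).bary y' - (G.subdivide e t).bary (vertex _ none) :=
      G.lap_extendPotential e t h
    rw [r_onEdge_left, r_vertex_left_eq _ hlap, ← hlap, G.lap_extendPotential e t h,
      dotProduct_extendPotential, edgeTerm_onEdge_left]
    simp only [d, Pi.sub_apply, Pi.single_eq_same]
    ring

variable {G}

theorem Connected.r_comm (hG : G.Connected) (x y : G.Point) : G.r x y = G.r y x := by
  obtain ⟨f, hf⟩ := hG.exists_lap_eq_bary_sub x y
  rw [G.r_eq hf, G.r_eq (f := -f) (by rw [map_neg, hf, neg_sub])]
  simp [edgeTerm, abs_sub_comm, sub_dotProduct]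

end Resistance

section Regularity

variable {V E : Type*}

theorem measurable_of_onEdge {α : Type*} [MeasurableSpace α] {G : MetricMultigraph V E}
    {f : G.Point → α} (hf : ∀ e, Measurable fun t => f (G.onEdge e t)) : Measurable f := by
  let : MeasurableSpace V := ⊤
  refine measurable_fun_sum (f := f) measurable_from_top fun s hs => ?_
  rw [MeasurableSpace.measurableSet_iInf]
  exact fun e => hf e hs

variable [DecidableEq V] [DecidableEq E]

/-- Barycentric and edge coordinates together; they identify the metrized graph with a subset of a
finite-dimensional vector space, on which the resistance function is continuous. -/
def coord (G : MetricMultigraph V E) (x : G.Point) : (V → ℝ) × (E → ℝ) := (G.bary x, G.pos x)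

theorem measurable_coord (G : MetricMultigraph V E) : Measurable G.coord := by
  refine measurable_of_onEdge fun e => Measurable.prodMk ?_ ?_
  · simp only [bary_onEdge]
    refine measurable_pi_iff.2 fun v => ?_
    simp only [Pi.add_apply, Pi.smul_apply, smul_eq_mul]
    fun_prop
  · refine measurable_pi_iff.2 fun e' => ?_
    simp only [pos_onEdge, Pi.single_apply]
    split_ifs <;> fun_prop

variable [Fintype V]

theorem isCompact_closure_range_coord (G : MetricMultigraph V E) :
    IsCompact (closure (Set.range G.coord)) := by
  have hK : IsCompact (stdSimplex ℝ V ×ˢ Set.Icc 0 G.len) :=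
    (isCompact_stdSimplex ℝ V).prod isCompact_Icc
  refine hK.closure_of_subset ?_
  rintro _ ⟨x, rfl⟩
  exact ⟨G.bary_mem_stdSimplex x, fun e => (G.pos_mem_Icc x e).1, fun e => (G.pos_mem_Icc x e).2⟩

variable [Fintype E]

theorem Connected.exists_continuous_r {G : MetricMultigraph V E} (hG : G.Connected) :
    ∃ Φ : (V → ℝ) × (E → ℝ) → ℝ, Continuous Φ ∧
      ∀ x y, G.r x y = Φ (G.coord y - G.coord x) := by
  obtain ⟨z⟩ := hG.1
  obtain ⟨γ, hγ⟩ := hG.exists_green z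
  have := γ.continuous_of_finiteDimensional
  refine ⟨fun c => c.1 ⬝ᵥ γ c.1 + ∑ e, loopRes (G.len e) |c.2 e|, ?_, fun x y => ?_⟩
  · fun_prop
  · refine G.r_eq ?_
    rw [hγ]
    simp [coord, sum_bary]

variable {G : MetricMultigraph V E}

theorem Connected.measurable_r (hG : G.Connected) :
    Measurable fun z : G.Point × G.Point => G.r z.1 z.2 := by
  obtain ⟨Φ, hΦ, hr⟩ := hG.exists_continuous_r
  simp only [hr]
  exact hΦ.measurable.comp ((G.measurable_coord.comp measurable_snd).sub
    (G.measurable_coord.comp measurable_fst))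

theorem Connected.measurable_r_right (hG : G.Connected) (x : G.Point) : Measurable (G.r x) :=
  hG.measurable_r.comp measurable_prodMk_left

theorem Connected.exists_norm_r_le (hG : G.Connected) : ∃ C, ∀ x y, ‖G.r x y‖ ≤ C := by
  obtain ⟨Φ, hΦ, hr⟩ := hG.exists_continuous_r
  have hK := G.isCompact_closure_range_coord
  obtain ⟨C, hC⟩ := (hK.prod hK).exists_bound_of_continuousOn
    (f := fun c => Φ (c.2 - c.1)) (by fun_prop)
  exact ⟨C, fun x y => (congrArg norm (hr x y)).trans_le
    (hC (G.coord x, G.coord y) ⟨subset_closure ⟨x, rfl⟩, subset_closure ⟨y, rfl⟩⟩)⟩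

/-- The potential of a measure `μ` with respect to the resistance kernel. -/
def potential (G : MetricMultigraph V E) (μ : Measure G.Point) (x : G.Point) : ℝ :=
  ∫ y, G.r x y ∂μ

theorem Connected.integrable_r (hG : G.Connected) (μ : Measure G.Point) [IsFiniteMeasure μ]
    (x : G.Point) : Integrable (G.r x) μ := by
  obtain ⟨C, hC⟩ := hG.exists_norm_r_le
  exact .of_bound (hG.measurable_r_right x).aestronglyMeasurable C (.of_forall (hC x))

theorem Connected.measurable_potential (hG : G.Connected) (μ : Measure G.Point) [SFinite μ] :
    Measurable (G.potential μ) :=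
  hG.measurable_r.stronglyMeasurable.integral_prod_right'.measurable

theorem Connected.integrable_potential (hG : G.Connected) (μ ν : Measure G.Point)
    [IsFiniteMeasure μ] [IsFiniteMeasure ν] : Integrable (G.potential μ) ν := by
  obtain ⟨C, hC⟩ := hG.exists_norm_r_le
  exact .of_bound (hG.measurable_potential μ).aestronglyMeasurable (C * μ.real .univ)
    (.of_forall fun x => norm_integral_le_of_norm_le_const (.of_forall (hC x)))

end Regularity

section DeleteEdge

variable {V E : Type*}

/-- The inclusion of the graph without the edge `e`. -/
def ofDeleteEdge (G : MetricMultigraph V E) (e : E) : (G.deleteEdge e).Point → G.Point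
  | Sum.inl v => G.vertex v
  | Sum.inr ⟨e', t⟩ => G.onEdge e' t

theorem measurable_ofDeleteEdge (G : MetricMultigraph V E) (e : E) :
    Measurable (G.ofDeleteEdge e) :=
  measurable_of_onEdge fun e' => G.measurable_onEdge e'

theorem Connected.deleteEdge_of_loop {G : MetricMultigraph V E} (hG : G.Connected) {e : E}
    (he : G.src e = G.tgt e) : (G.deleteEdge e).Connected := by
  refine ⟨hG.1, fun u v => ?_⟩
  induction hG.2 u v with
  | rel a b h =>
    obtain ⟨e', rfl, rfl⟩ := h
    obtain rfl | hne := eq_or_ne e' e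
    · rw [he]
      exact .refl _
    · exact .rel _ _ ⟨⟨e', hne⟩, rfl, rfl⟩
  | refl a => exact .refl a
  | symm a b _ ih => exact ih.symm
  | trans a b c _ _ ih₁ ih₂ => exact ih₁.trans _ _ _ ih₂

theorem bary_ofDeleteEdge [DecidableEq V] (G : MetricMultigraph V E) (e : E)
    (x : (G.deleteEdge e).Point) : G.bary (G.ofDeleteEdge e x) = (G.deleteEdge e).bary x := by
  induction x using Point.cases <;> rfl

variable [DecidableEq E]

theorem pos_ofDeleteEdge_self (G : MetricMultigraph V E) (e : E) (x : (G.deleteEdge e).Point) :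
    G.pos (G.ofDeleteEdge e x) e = 0 := by
  induction x using Point.cases with
  | vertex v => rfl
  | onEdge e' t => exact Pi.single_eq_of_ne e'.2.symm _

theorem pos_ofDeleteEdge (G : MetricMultigraph V E) (e : E) (x : (G.deleteEdge e).Point)
    (e' : {e' // e' ≠ e}) : G.pos (G.ofDeleteEdge e x) e' = (G.deleteEdge e).pos x e' := by
  induction x using Point.cases with
  | vertex v => rfl
  | onEdge e'' t =>
    change (Pi.single (e'' : E) (t : ℝ) : E → ℝ) e' =
      (Pi.single e'' (t : ℝ) : {e' // e' ≠ e} → ℝ) e'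
    simp only [Pi.single_apply, Subtype.ext_iff]

variable [Fintype E]

theorem totalLength_deleteEdge (G : MetricMultigraph V E) (e : E) :
    G.totalLength = G.len e + (G.deleteEdge e).totalLength :=
  Fintype.sum_eq_add_sum_subtype_ne G.len e

theorem edgeTerm_ofDeleteEdge (G : MetricMultigraph V E) (e : E) (x y : (G.deleteEdge e).Point) :
    G.edgeTerm (G.ofDeleteEdge e x) (G.ofDeleteEdge e y) = (G.deleteEdge e).edgeTerm x y := by
  rw [edgeTerm, Fintype.sum_eq_add_sum_subtype_ne _ e]
  simp only [pos_ofDeleteEdge_self, pos_ofDeleteEdge, sub_self, abs_zero, loopRes_zero_right,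
    zero_add]
  rfl

theorem edgeTerm_onEdge_right (G : MetricMultigraph V E) (x : G.Point) (v : V) (e : E)
    (t : Set.Ioo (0 : ℝ) (G.len e)) :
    G.edgeTerm x (G.onEdge e t) = G.edgeTerm x (G.vertex v) +
      (loopRes (G.len e) |t - G.pos x e| - loopRes (G.len e) (G.pos x e)) := by
  have other (e' : {e' // e' ≠ e}) : G.pos (G.onEdge e t) e' = 0 := Pi.single_eq_of_ne e'.2 _
  rw [edgeTerm, edgeTerm, Fintype.sum_eq_add_sum_subtype_ne _ e,
    Fintype.sum_eq_add_sum_subtype_ne _ e]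
  simp only [other, pos_vertex, Pi.zero_apply, pos_onEdge, Pi.single_eq_same, zero_sub, abs_neg,
    abs_of_nonneg (G.pos_mem_Icc x e).1]
  ring

variable [DecidableEq V]

theorem lap_eq_add_lap_deleteEdge (G : MetricMultigraph V E) (e : E) (f : V → ℝ) :
    G.lap f = ((f (G.src e) - f (G.tgt e)) / G.len e) •
      (Pi.single (G.src e) (1 : ℝ) - Pi.single (G.tgt e) 1) + (G.deleteEdge e).lap f := by
  rw [lap_apply, Fintype.sum_eq_add_sum_subtype_ne _ e]
  rfl

theorem lap_deleteEdge_of_loop {G : MetricMultigraph V E} {e : E} (he : G.src e = G.tgt e) :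
    (G.deleteEdge e).lap = G.lap := by
  ext1 f
  simp [lap_eq_add_lap_deleteEdge G e, he]

theorem edgeRes_deleteEdge_of_loop {G : MetricMultigraph V E} {e : E} (he : G.src e = G.tgt e)
    (e' : {e' : E // e' ≠ e}) : (G.deleteEdge e).edgeRes e' = G.edgeRes e' := by
  have hlap (f : V → ℝ) : ((G.deleteEdge e).deleteEdge e').lap f = (G.deleteEdge e').lap f := by
    have h := lap_eq_add_lap_deleteEdge (G.deleteEdge e) e' f
    rw [lap_deleteEdge_of_loop he, lap_eq_add_lap_deleteEdge G e'] at h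
    exact (add_left_cancel h).symm
  simp only [edgeRes, effRes, isPotential_iff, hlap]
  rfl

variable [Fintype V]

theorem edgeRes_of_loop {G : MetricMultigraph V E} {e : E} (he : G.src e = G.tgt e) :
    G.edgeRes e = 0 := by
  have h : (G.deleteEdge e).IsPotential (G.src e) (G.tgt e) 0 :=
    isPotential_iff.2 (by rw [map_zero, he, sub_self])
  simp [edgeRes, effRes_eq h]

variable {G : MetricMultigraph V E} (hG : G.Connected) {e : E} (he : G.src e = G.tgt e)
include hG he

theorem Connected.r_ofDeleteEdge_of_loop (x y : (G.deleteEdge e).Point) :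
    G.r (G.ofDeleteEdge e x) (G.ofDeleteEdge e y) = (G.deleteEdge e).r x y := by
  obtain ⟨f, hf⟩ := hG.exists_lap_eq_bary_sub (G.ofDeleteEdge e x) (G.ofDeleteEdge e y)
  have hf' : (G.deleteEdge e).lap f = (G.deleteEdge e).bary y - (G.deleteEdge e).bary x := by
    rw [lap_deleteEdge_of_loop he, hf, bary_ofDeleteEdge, bary_ofDeleteEdge]
  rw [G.r_eq hf, r_eq _ hf', edgeTerm_ofDeleteEdge, bary_ofDeleteEdge, bary_ofDeleteEdge]

theorem Connected.r_onEdge_of_loop (x : G.Point) (t : Set.Ioo (0 : ℝ) (G.len e)) :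
    G.r x (G.onEdge e t) = G.r x (G.vertex (G.src e)) +
      (loopRes (G.len e) |t - G.pos x e| - loopRes (G.len e) (G.pos x e)) := by
  obtain ⟨f, hf⟩ := hG.exists_lap_eq_bary_sub x (G.vertex (G.src e))
  have hb := bary_onEdge_of_loop he t
  rw [G.r_eq hf, G.r_eq (hb ▸ hf), hb, edgeTerm_onEdge_right, add_assoc]

end DeleteEdge

section Foster

variable {V E : Type*} [DecidableEq V] [DecidableEq E] [Fintype V] [Fintype E]
  {G : MetricMultigraph V E}

/-- The drop of `f` is the resistance of `e` and `G.deleteEdge e` in parallel, i.e.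
`len e * R / (len e + R)` with `R = G.edgeRes e`. -/
theorem IsPotential.inv_len_add_edgeRes_mul_len {e : E} {f : V → ℝ}
    (hf : G.IsPotential (G.src e) (G.tgt e) f) :
    ((ENNReal.ofReal (G.len e) + G.edgeRes e)⁻¹).toReal * G.len e =
      1 - (f (G.tgt e) - f (G.src e)) / G.len e := by
  set D := f (G.tgt e) - f (G.src e) with hD
  set c := 1 - D / G.len e with hc
  have hl := G.len_pos e
  have hDc : D = G.len e * (1 - c) := by rw [hc]; field_simp; ring
  have hlap : (G.deleteEdge e).lap f = c • (Pi.single (G.tgt e) 1 - Pi.single (G.src e) 1) := by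
    have h := isPotential_iff.1 hf
    rw [lap_eq_add_lap_deleteEdge G e, ← eq_sub_iff_add_eq'] at h
    rw [h, hc, hD]
    module
  by_cases hc0 : c = 0
  · have bridge : G.edgeRes e = ⊤ := by
      refine iInf₂_eq_top.2 fun b hb => ?_
      have h := lap_dotProduct_comm (G.deleteEdge e) b f
      rw [isPotential_iff.1 hb, hlap, hc0, zero_smul, dotProduct_zero, sub_dotProduct,
        single_one_dotProduct, single_one_dotProduct, ← hD, hDc, hc0] at h
      simp [hl.ne'] at h
    simp [bridge, hc0]
  · have hpot : (G.deleteEdge e).IsPotential (G.src e) (G.tgt e) (c⁻¹ • f) := by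
      rw [isPotential_iff, map_smul, hlap, inv_smul_smul₀ hc0]
    have hdrop : (c⁻¹ • f) (G.tgt e) - (c⁻¹ • f) (G.src e) = c⁻¹ * D := by simp [hD, mul_sub]
    have hsum : G.len e + c⁻¹ * D = G.len e * c⁻¹ := by rw [hDc]; field_simp; ring
    have hnn := hpot.drop_nonneg
    rw [edgeRes, effRes_eq hpot, ← ENNReal.ofReal_add hl.le hnn, ENNReal.toReal_inv,
      ENNReal.toReal_ofReal (add_nonneg hl.le hnn), hdrop, hsum]
    field_simp

/-- Foster's theorem: both sides compute the trace of the Laplacian composed with its Green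
operator, the left one edge by edge and the right one vertex by vertex. -/
theorem Connected.sum_inv_len_add_edgeRes_mul_len (hG : G.Connected) :
    ∑ e, ((ENNReal.ofReal (G.len e) + G.edgeRes e)⁻¹).toReal * G.len e =
      Fintype.card E - Fintype.card V + 1 := by
  obtain ⟨z⟩ := hG.1
  obtain ⟨γ, hγ⟩ := hG.exists_green z
  let f (e : E) : V → ℝ := γ (Pi.single (G.tgt e) 1 - Pi.single (G.src e) 1)
  have hf (e : E) : G.IsPotential (G.src e) (G.tgt e) (f e) := by
    simp [isPotential_iff, f, hγ]
  have trace : ∑ v, G.lap (γ (Pi.single v 1)) v = Fintype.card V - 1 := by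
    simp [hγ]
  have trace' : ∑ v, G.lap (γ (Pi.single v 1)) v =
      ∑ e, (f e (G.tgt e) - f e (G.src e)) / G.len e := by
    simp only [lap_apply, Finset.sum_apply]
    rw [Finset.sum_comm]
    refine Finset.sum_congr rfl fun e _ => ?_
    simp only [f, map_sub, Pi.smul_apply, Pi.sub_apply, Pi.single_apply, smul_eq_mul, mul_sub,
      mul_ite, mul_one, mul_zero, Finset.sum_sub_distrib, Finset.sum_ite_eq', Finset.mem_univ,
      if_true]
    ring
  simp only [(hf _).inv_len_add_edgeRes_mul_len, Finset.sum_sub_distrib, ← trace', trace,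
    Finset.sum_const, Finset.card_univ, nsmul_one]
  ring

end Foster

section Genus

variable {V E : Type*} [DecidableEq V] [Fintype E]

section

variable [Fintype V] (G : MetricMultigraph V E) (q : V → ℕ)

theorem sum_valence : ∑ p, G.valence p = 2 * Fintype.card E := by
  simp only [valence, Finset.card_filter, Finset.sum_add_distrib]
  rw [Finset.sum_comm, Finset.sum_comm (γ := V)]
  simp [two_mul]

theorem sum_K : ∑ p, G.K q p = 2 * G.genus q - 2 := by
  simp only [K, genus, Finset.sum_add_distrib, Finset.sum_sub_distrib, ← Finset.mul_sum,
    ← Nat.cast_sum, sum_valence, Finset.sum_const, Finset.card_univ, nsmul_eq_mul]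
  push_cast
  ring

variable {G q}

theorem IsPMGraph.genus_pos (hG : G.IsPMGraph q) : 0 < G.genus q := by
  have h : 0 ≤ ∑ p, G.K q p := Finset.sum_nonneg fun p _ => hG.2 p
  rw [sum_K] at h
  lia

end

variable [DecidableEq E] (G : MetricMultigraph V E) (q : V → ℕ) (e : E)

theorem valence_eq_add_valence_deleteEdge :
    G.valence = Pi.single (G.src e) 1 + Pi.single (G.tgt e) 1 + (G.deleteEdge e).valence := by
  have split (f : E → V) (v : V) : (Finset.univ.filter fun e' => f e' = v).card =
      (Pi.single (f e) 1 : V → ℕ) v +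
        (Finset.univ.filter fun e' : {e' // e' ≠ e} => f e' = v).card := by
    rw [Finset.card_filter, Fintype.sum_eq_add_sum_subtype_ne _ e, ← Finset.card_filter]
    simp only [Pi.single_apply, eq_comm (a := v)]
  ext v
  rw [valence, split G.src, split G.tgt, add_add_add_comm]
  rfl

theorem genus_deleteEdge [Fintype V] (p : V) :
    (G.deleteEdge e).genus (q + Pi.single p 1) = G.genus q := by
  have hE : (Fintype.card E : ℤ) = 1 + Fintype.card {e' : E // e' ≠ e} := by
    simpa using Fintype.sum_eq_add_sum_subtype_ne (fun _ => (1 : ℤ)) e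
  simp only [genus, hE, Pi.add_apply, Nat.cast_add, Finset.sum_add_distrib, ← Nat.cast_sum,
    Finset.sum_pi_single', Finset.mem_univ, if_true, Nat.cast_one]
  ring

variable {G q e} (he : G.src e = G.tgt e)
include he

theorem K_deleteEdge_of_loop : (G.deleteEdge e).K (q + Pi.single (G.src e) 1) = G.K q := by
  ext v
  simp only [K, G.valence_eq_add_valence_deleteEdge e, ← he, Pi.add_apply]
  push_cast
  ring

theorem IsPMGraph.deleteEdge_of_loop (hG : G.IsPMGraph q) :
    (G.deleteEdge e).IsPMGraph (q + Pi.single (G.src e) 1) :=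
  ⟨hG.1.deleteEdge_of_loop he, K_deleteEdge_of_loop he ▸ hG.2⟩

end Genus

section Measures

variable {V E : Type*} (G : MetricMultigraph V E) (e : E)

theorem edgeMeasure_univ : G.edgeMeasure e .univ = ENNReal.ofReal (G.len e) := by
  rw [edgeMeasure, Measure.map_apply (G.measurable_onEdge e) .univ, Set.preimage_univ,
    comap_subtype_coe_apply measurableSet_Ioo, Set.image_univ, Subtype.range_coe, Real.volume_Ioo,
    sub_zero]

instance : IsFiniteMeasure (G.edgeMeasure e) :=
  ⟨by simp only [edgeMeasure_univ, ENNReal.ofReal_lt_top]⟩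

theorem integral_edgeMeasure {F : G.Point → ℝ} (hF : Measurable F) (f : ℝ → ℝ)
    (h : ∀ t, F (G.onEdge e t) = f t) :
    ∫ x, F x ∂G.edgeMeasure e = ∫ t in 0..G.len e, f t := by
  rw [edgeMeasure, integral_map (G.measurable_onEdge e).aemeasurable hF.aestronglyMeasurable,
    intervalIntegral.integral_of_le (G.len_pos e).le, integral_Ioc_eq_integral_Ioo]
  simp only [h]
  exact integral_subtype_comap measurableSet_Ioo f

theorem map_edgeMeasure_deleteEdge (e' : {e' // e' ≠ e}) :
    ((G.deleteEdge e).edgeMeasure e').map (G.ofDeleteEdge e) = G.edgeMeasure e' := by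
  rw [edgeMeasure, Measure.map_map (G.measurable_ofDeleteEdge e) (measurable_onEdge _ _)]
  rfl

theorem map_dirac_vertex_deleteEdge (v : V) :
    (Measure.dirac ((G.deleteEdge e).vertex v)).map (G.ofDeleteEdge e) =
      Measure.dirac (G.vertex v) :=
  Measure.map_dirac' (G.measurable_ofDeleteEdge e) _

variable [DecidableEq V] [Fintype V] [Fintype E] (q : V → ℕ)

instance : IsFiniteMeasure (G.deltaK q) := by
  have (p : V) : IsFiniteMeasure (ENNReal.ofReal (G.K q p : ℝ) • Measure.dirac (G.vertex p)) :=
    Measure.smul_finite _ ENNReal.ofReal_ne_top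
  unfold deltaK
  infer_instance

variable {G e q}

theorem IsPMGraph.deltaK_real_univ (hG : G.IsPMGraph q) :
    (G.deltaK q).real .univ = 2 * G.genus q - 2 := by
  have hK (p : V) : 0 ≤ (G.K q p : ℝ) := Int.cast_nonneg (hG.2 p)
  have mass : G.deltaK q .univ = ENNReal.ofReal (∑ p, G.K q p) := by
    simp [deltaK, Measure.finsetSum_apply, ENNReal.ofReal_sum_of_nonneg fun p _ => hK p]
  rw [Measure.real, mass, ENNReal.toReal_ofReal (Finset.sum_nonneg fun p _ => hK p),
    ← Int.cast_sum, sum_K]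
  push_cast
  rfl

variable [DecidableEq E]

theorem map_deltaK_deleteEdge_of_loop (he : G.src e = G.tgt e) :
    ((G.deleteEdge e).deltaK (q + Pi.single (G.src e) 1)).map (G.ofDeleteEdge e) =
      G.deltaK q := by
  rw [deltaK, K_deleteEdge_of_loop he, Measure.map_finset_sum
    (G.measurable_ofDeleteEdge e).aemeasurable]
  simp only [Measure.map_smul, map_dirac_vertex_deleteEdge]
  rfl

theorem Connected.isProbabilityMeasure_muAd (hG : G.Connected) (hg : 0 < G.genus q) :
    IsProbabilityMeasure (G.muAd q) := by
  have weight (e : E) : (ENNReal.ofReal (G.len e) + G.edgeRes e)⁻¹ ≠ ⊤ := by simp [G.len_pos e]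
  have mass_nonneg (e : E) :
      0 ≤ ((ENNReal.ofReal (G.len e) + G.edgeRes e)⁻¹).toReal * G.len e :=
    mul_nonneg ENNReal.toReal_nonneg (G.len_pos e).le
  have edges : ∑ e, (ENNReal.ofReal (G.len e) + G.edgeRes e)⁻¹ * ENNReal.ofReal (G.len e) =
      ENNReal.ofReal (Fintype.card E - Fintype.card V + 1) := by
    rw [← hG.sum_inv_len_add_edgeRes_mul_len, ENNReal.ofReal_sum_of_nonneg fun e _ => mass_nonneg e]
    refine Finset.sum_congr rfl fun e _ => ?_
    rw [ENNReal.ofReal_mul ENNReal.toReal_nonneg, ENNReal.ofReal_toReal (weight e)]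
  have genus_eq : ENNReal.ofReal (G.genus q : ℝ) =
      ∑ p, (q p : ℝ≥0∞) + ENNReal.ofReal (Fintype.card E - Fintype.card V + 1) := by
    rw [← Nat.cast_sum, ← ENNReal.ofReal_natCast, ← ENNReal.ofReal_add (Nat.cast_nonneg _)
      (hG.sum_inv_len_add_edgeRes_mul_len ▸ Finset.sum_nonneg fun e _ => mass_nonneg e), genus]
    push_cast
    rw [add_comm]
  refine ⟨?_⟩
  simp only [muAd, Measure.smul_apply, Measure.add_apply, Measure.finsetSum_apply, measure_univ,
    edgeMeasure_univ, smul_eq_mul, mul_one, edges, ← genus_eq]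
  exact ENNReal.inv_mul_cancel (by simpa using hg) ENNReal.ofReal_ne_top

theorem muAd_add_smul_dirac_of_loop (he : G.src e = G.tgt e) :
    G.muAd q + (ENNReal.ofReal (G.genus q))⁻¹ • Measure.dirac (G.vertex (G.src e)) =
      ((G.deleteEdge e).muAd (q + Pi.single (G.src e) 1)).map (G.ofDeleteEdge e) +
        (ENNReal.ofReal (G.genus q))⁻¹ • (ENNReal.ofReal (G.len e))⁻¹ • G.edgeMeasure e := by
  have hι := G.measurable_ofDeleteEdge e
  have vertices : ∑ p, ((q + Pi.single (G.src e) 1 : V → ℕ) p : ℝ≥0∞) •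
        Measure.dirac (G.vertex p) =
      ∑ p, (q p : ℝ≥0∞) • Measure.dirac (G.vertex p) + Measure.dirac (G.vertex (G.src e)) := by
    simp only [Pi.add_apply, Nat.cast_add, add_smul, Finset.sum_add_distrib, Pi.single_apply,
      Nat.cast_ite, Nat.cast_one, Nat.cast_zero, ite_smul, one_smul, zero_smul,
      Finset.sum_ite_eq', Finset.mem_univ, if_true]
  rw [muAd, muAd, genus_deleteEdge, Fintype.sum_eq_add_sum_subtype_ne _ e, edgeRes_of_loop he,
    add_zero, Measure.map_smul, Measure.map_add _ _ hι, Measure.map_finset_sum hι.aemeasurable,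
    Measure.map_finset_sum hι.aemeasurable]
  simp only [Measure.map_smul, map_dirac_vertex_deleteEdge, map_edgeMeasure_deleteEdge,
    edgeRes_deleteEdge_of_loop he, vertices, ← smul_add]
  congr 1
  change _ = _ + ∑ e' : {e' // e' ≠ e},
    (ENNReal.ofReal (G.len e') + G.edgeRes e')⁻¹ • G.edgeMeasure e' + _
  abel

theorem integral_muAd_of_loop (he : G.src e = G.tgt e) (hg : 0 < G.genus q) {F : G.Point → ℝ}
    (hF : Measurable F) (hint : Integrable F (G.muAd q)) :
    ∫ x, F x ∂G.muAd q =
      ∫ x, F (G.ofDeleteEdge e x) ∂(G.deleteEdge e).muAd (q + Pi.single (G.src e) 1) +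
        (G.genus q : ℝ)⁻¹ *
          ((G.len e)⁻¹ * ∫ x, F x ∂G.edgeMeasure e - F (G.vertex (G.src e))) := by
  have hdirac : Integrable F
      ((ENNReal.ofReal (G.genus q))⁻¹ • Measure.dirac (G.vertex (G.src e))) :=
    (integrable_dirac' hF.stronglyMeasurable enorm_lt_top).smul_measure (by simpa using hg)
  have hsum := hint.add_measure hdirac
  rw [muAd_add_smul_dirac_of_loop he, integrable_add_measure] at hsum
  have h := congrArg (fun μ => ∫ x, F x ∂μ) (muAd_add_smul_dirac_of_loop (q := q) he)
  simp only [integral_add_measure hint hdirac, integral_add_measure hsum.1 hsum.2,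
    integral_smul_measure, integral_map (G.measurable_ofDeleteEdge e).aemeasurable
      hF.aestronglyMeasurable, integral_dirac' _ _ hF.stronglyMeasurable, ENNReal.toReal_inv,
    ENNReal.toReal_ofReal (G.len_pos e).le,
    ENNReal.toReal_ofReal (show (0 : ℝ) ≤ G.genus q from Int.cast_nonneg hg.le),
    smul_eq_mul] at h
  linear_combination h

end Measures

section Loop

variable {V E : Type*} [DecidableEq V] [DecidableEq E] [Fintype V] [Fintype E]
  {G : MetricMultigraph V E} {q : V → ℕ} {e : E} (he : G.src e = G.tgt e)
include he

theorem Connected.potential_edgeMeasure_of_loop (hG : G.Connected) (x : G.Point) :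
    G.potential (G.edgeMeasure e) x = G.len e *
      (G.r x (G.vertex (G.src e)) + (G.len e / 6 - loopRes (G.len e) (G.pos x e))) := by
  have hl := (G.len_pos e).ne'
  have hint : IntervalIntegrable (fun t => loopRes (G.len e) |t - G.pos x e|) volume 0 (G.len e) :=
    Continuous.intervalIntegrable (by fun_prop) _ _
  rw [potential, G.integral_edgeMeasure e (hG.measurable_r_right x)
      (fun t => G.r x (G.vertex (G.src e)) +
        (loopRes (G.len e) |t - G.pos x e| - loopRes (G.len e) (G.pos x e)))
      (hG.r_onEdge_of_loop he x),
    intervalIntegral.integral_add (by simp) (hint.sub (by simp)),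
    intervalIntegral.integral_sub hint (by simp), integral_loopRes_abs_sub hl (G.pos_mem_Icc x e),
    intervalIntegral.integral_const, intervalIntegral.integral_const, sub_zero, smul_eq_mul,
    smul_eq_mul]
  ring

theorem Connected.potential_muAd_of_loop (hG : G.Connected) (hg : 0 < G.genus q) (x : G.Point) :
    G.potential (G.muAd q) x =
      ∫ y, G.r x (G.ofDeleteEdge e y) ∂(G.deleteEdge e).muAd (q + Pi.single (G.src e) 1) +
        (G.genus q : ℝ)⁻¹ * (G.len e / 6 - loopRes (G.len e) (G.pos x e)) := by
  have := hG.isProbabilityMeasure_muAd hg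
  have hl := (G.len_pos e).ne'
  rw [potential, integral_muAd_of_loop he hg (hG.measurable_r_right x)
    (hG.integrable_r _ x), ← potential, hG.potential_edgeMeasure_of_loop he,
    inv_mul_cancel_left₀ hl, add_sub_cancel_left]

theorem Connected.potential_muAd_ofDeleteEdge (hG : G.Connected) (hg : 0 < G.genus q)
    (x : (G.deleteEdge e).Point) :
    G.potential (G.muAd q) (G.ofDeleteEdge e x) =
      (G.deleteEdge e).potential ((G.deleteEdge e).muAd (q + Pi.single (G.src e) 1)) x +
        (G.genus q : ℝ)⁻¹ * (G.len e / 6) := by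
  rw [hG.potential_muAd_of_loop he hg, pos_ofDeleteEdge_self, loopRes_zero_right, sub_zero]
  simp only [hG.r_ofDeleteEdge_of_loop he, potential]

theorem Connected.potential_muAd_onEdge (hG : G.Connected) (hg : 0 < G.genus q)
    (s : Set.Ioo (0 : ℝ) (G.len e)) :
    G.potential (G.muAd q) (G.onEdge e s) =
      G.potential (G.muAd q) (G.vertex (G.src e)) +
        (1 - (G.genus q : ℝ)⁻¹) * loopRes (G.len e) s := by
  have hβ := (hG.deleteEdge_of_loop he).isProbabilityMeasure_muAd
    (q := q + Pi.single (G.src e) 1) (by rwa [genus_deleteEdge])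
  have hr (y : (G.deleteEdge e).Point) : G.r (G.onEdge e s) (G.ofDeleteEdge e y) =
      G.r (G.vertex (G.src e)) (G.ofDeleteEdge e y) + loopRes (G.len e) s := by
    rw [hG.r_comm, hG.r_onEdge_of_loop he, hG.r_comm, pos_ofDeleteEdge_self, sub_zero,
      abs_of_pos s.2.1, loopRes_zero_right, sub_zero]
  have hint : Integrable (fun y => G.r (G.vertex (G.src e)) (G.ofDeleteEdge e y))
      ((G.deleteEdge e).muAd (q + Pi.single (G.src e) 1)) :=
    ((hG.deleteEdge_of_loop he).integrable_r _ (vertex _ (G.src e))).congr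
      (.of_forall fun y => (hG.r_ofDeleteEdge_of_loop he _ y).symm)
  rw [hG.potential_muAd_of_loop he hg, hG.potential_muAd_of_loop he hg]
  simp only [hr, integral_add hint (integrable_const _), integral_const, probReal_univ, one_smul,
    pos_onEdge, Pi.single_eq_same, pos_vertex, Pi.zero_apply, loopRes_zero_right]
  ring

theorem Connected.zInv_of_loop (hG : G.Connected) (hg : 0 < G.genus q) :
    G.zInv q = (G.deleteEdge e).zInv (q + Pi.single (G.src e) 1) +
      (2 * (G.genus q : ℝ) - 1) / (12 * (G.genus q : ℝ) ^ 2) * G.len e := by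
  have hβ := hG.deleteEdge_of_loop he
  have := hG.isProbabilityMeasure_muAd hg
  have := hβ.isProbabilityMeasure_muAd (q := q + Pi.single (G.src e) 1) (by rwa [genus_deleteEdge])
  have hg' : (G.genus q : ℝ) ≠ 0 := Int.cast_ne_zero.2 hg.ne'
  have hl := (G.len_pos e).ne'
  have hmeas := hG.measurable_potential (G.muAd q)
  have along_loop : ∫ x, G.potential (G.muAd q) x ∂G.edgeMeasure e =
      G.len e * (G.potential (G.muAd q) (G.vertex (G.src e)) +
        (1 - (G.genus q : ℝ)⁻¹) * (G.len e / 6)) := by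
    have hint : IntervalIntegrable (loopRes (G.len e)) volume 0 (G.len e) :=
      (continuous_loopRes _).intervalIntegrable _ _
    rw [G.integral_edgeMeasure e hmeas
        (fun t => G.potential (G.muAd q) (G.vertex (G.src e)) +
          (1 - (G.genus q : ℝ)⁻¹) * loopRes (G.len e) t)
        (hG.potential_muAd_onEdge he hg),
      intervalIntegral.integral_add (by simp) (hint.const_mul _),
      intervalIntegral.integral_const_mul, integral_loopRes hl, intervalIntegral.integral_const,
      sub_zero, smul_eq_mul]
    ring
  have key := integral_muAd_of_loop he hg hmeas (hG.integrable_potential _ _)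
  simp only [hG.potential_muAd_ofDeleteEdge he hg, integral_add (hβ.integrable_potential _ _)
    (integrable_const _), integral_const, probReal_univ, one_smul, along_loop] at key
  change 1 / 2 * ∫ x, G.potential (G.muAd q) x ∂G.muAd q =
    1 / 2 * ∫ x, (G.deleteEdge e).potential _ x ∂_ + _
  rw [key]
  field_simp
  ring

theorem IsPMGraph.epsilonInv_of_loop (hG : G.IsPMGraph q) :
    G.epsilonInv q = (G.deleteEdge e).epsilonInv (q + Pi.single (G.src e) 1) +
      ((G.genus q : ℝ) - 1) / (3 * (G.genus q : ℝ)) * G.len e := by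
  have hβ := hG.deleteEdge_of_loop he
  have := hG.1.isProbabilityMeasure_muAd hG.genus_pos
  have := hβ.1.isProbabilityMeasure_muAd hβ.genus_pos
  have hg : (G.genus q : ℝ) ≠ 0 := Int.cast_ne_zero.2 hG.genus_pos.ne'
  change ∫ x, G.potential (G.muAd q) x ∂G.deltaK q =
    ∫ x, (G.deleteEdge e).potential _ x ∂(G.deleteEdge e).deltaK _ + _
  rw [← map_deltaK_deleteEdge_of_loop he, integral_map (G.measurable_ofDeleteEdge e).aemeasurable
    (hG.1.measurable_potential _).aestronglyMeasurable]
  simp only [hG.1.potential_muAd_ofDeleteEdge he hG.genus_pos]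
  rw [integral_add (hβ.1.integrable_potential _ _) (integrable_const _), integral_const,
    hβ.deltaK_real_univ, genus_deleteEdge, smul_eq_mul]
  field_simp
  ring

theorem IsPMGraph.phiInv_of_loop (hG : G.IsPMGraph q) :
    G.phiInv q = (G.deleteEdge e).phiInv (q + Pi.single (G.src e) 1) +
      ((G.genus q : ℝ) - 1) / (6 * (G.genus q : ℝ)) * G.len e := by
  have hg : (G.genus q : ℝ) ≠ 0 := Int.cast_ne_zero.2 hG.genus_pos.ne'
  rw [phiInv, phiInv, genus_deleteEdge, hG.1.zInv_of_loop he hG.genus_pos, hG.epsilonInv_of_loop he,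
    G.totalLength_deleteEdge e]
  field_simp
  ring

theorem IsPMGraph.lambdaInv_of_loop (hG : G.IsPMGraph q) :
    G.lambdaInv q = (G.deleteEdge e).lambdaInv (q + Pi.single (G.src e) 1) +
      (G.genus q : ℝ) / (8 * (G.genus q : ℝ) + 4) * G.len e := by
  have hg : 0 < (G.genus q : ℝ) := Int.cast_pos.2 hG.genus_pos
  rw [lambdaInv, lambdaInv, genus_deleteEdge, hG.phiInv_of_loop he, hG.epsilonInv_of_loop he,
    G.totalLength_deleteEdge e]
  field_simp
  ring

end Loop

end MetricMultigraph

end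

theorem mainTheorem4 {V E : Type*} [DecidableEq V] [DecidableEq E] [Fintype V] [Fintype E]
    (Γ : MetricMultigraph V E) (q : V → ℕ) (hΓ : Γ.IsPMGraph q)
    (p : V) (loop : E) (hsrc : Γ.src loop = p) (htgt : Γ.tgt loop = p)
    (hp : 3 ≤ Γ.valence p)
    (L : ℝ) (hL : Γ.len loop = L)
    (β : MetricMultigraph V {e : E // e ≠ loop}) (hβ : β = Γ.deleteEdge loop)
    (q' : V → ℕ) (hq' : q' = Function.update q p (q p + 1))
    (g : ℝ) (hg : g = (Γ.genus q : ℝ)) :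
    β.IsPMGraph q' ∧
    β.genus q' = Γ.genus q ∧
    Γ.phiInv q = β.phiInv q' + (g - 1) / (6 * g) * L ∧
    Γ.zInv q = β.zInv q' + (2 * g - 1) / (12 * g ^ 2) * L ∧
    Γ.lambdaInv q = β.lambdaInv q' + g / (8 * g + 4) * L ∧
    Γ.epsilonInv q = β.epsilonInv q' + (g - 1) / (3 * g) * L := by
  subst hβ hq' hL hg hsrc
  have hupdate : Function.update q (Γ.src loop) (q (Γ.src loop) + 1) =
      q + Pi.single (Γ.src loop) 1 := by
    ext v
    obtain rfl | hv := eq_or_ne v (Γ.src loop)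
    · simp
    · simp [hv]
  rw [hupdate]
  exact ⟨hΓ.deleteEdge_of_loop htgt.symm, Γ.genus_deleteEdge q loop _,
    hΓ.phiInv_of_loop htgt.symm, hΓ.1.zInv_of_loop htgt.symm hΓ.genus_pos,
    hΓ.lambdaInv_of_loop htgt.symm, hΓ.epsilonInv_of_loop htgt.symm⟩
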